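/- **Definitions.** A metric space $X$ is *geodesic* if any two points $x,y$ are joined by an isometric image of $[0,d(x,y)]$. Let $\varepsilon>0$. An *$\varepsilon$-chain* is a finite sequence $\{x_0,\dots,x_n\}$ in $X$ with $d(x_i,x_{i+1})<\varepsilon$ for all $i$; it is an *$\varepsilon$-loop* if $x_0=x_n$. Two $\varepsilon$-chains with the same endpoints are *$\varepsilon$-homotopic* if one is obtained from the other by finitely many steps, each adding or removing a single point, such that all intermediate sequences are $\varepsilon$-chains with the same endpoints. An $\varepsilon$-loop is *$\varepsilon$-null* if it is $\varepsilon$-homotopic to $\{x_0\}$. Two $\varepsilon$-loops $\lambda_1,\lambda_2$ are *freely $\varepsilon$-homotopic* if there are $\varepsilon$-chains $\alpha,\beta$ with a common first point, ending at the starting points of $\lambda_1,\lambda_2$ respectively, such that $\alpha*\lambda_1*\overline{\alpha}$ is $\varepsilon$-homotopic to $\beta*\lambda_2*\overline{\beta}$ (here $*$ is concatenation and the bar is reversal). A number $\varepsilon>0$ is a *homotopy critical value* of $X$ if there is an $\varepsilon$-loop that is not $\varepsilon$-null but is $\delta$-null for every $\delta>\varepsilon$; the set of these values is the *homotopy critical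 spectrum* of $X$. An *$\varepsilon$-triad* is a triple $T=\{x_0,x_1,x_2\}$ with $d(x_i,x_j)=\varepsilon$ for $i\ne j$; put $\alpha_T=\{x_0,x_1,x_2,x_0\}$. A *midpoint refinement* of a sequence is obtained by inserting a midpoint between each point and its successor. $T$ is *essential* if some midpoint refinement of $\alpha_T$ is not $\varepsilon$-null. Essential $\varepsilon$-triads $T_1,T_2$ are *equivalent* if a midpoint refinement of $\alpha_{T_1}$ is freely $\varepsilon$-homotopic to a midpoint refinement of $\alpha_{T_2}$ or of $\overline{\alpha_{T_2}}$. The *multiplicity* of a homotopy critical value $\varepsilon$ is the number of non-equivalent essential $\varepsilon$-triads, i.e. the supremum of the cardinalities of sets of pairwise non-equivalent essential $\varepsilon$-triads. **Theorem.** Let $\mathcal X$ be a Gromov–Hausdorff precompact collection of (nonempty) compact geodesic spaces, i.e. the set of their isometry classes has compact closure in the Gromov–Hausdorff space of all nonempty compact metric spaces. For every $a>0$ there is a natural number $N$ such that for every $X\in\mathcal X$ the number of homotopy critical values of $X$ greater than $a$, counted with multiplicity (that is, the sum of their multiplicities), is at most $N$. Here the multiplicity of every homotopy critical value of a compact geodesic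 space is at least $1$. In particular, the homotopy critical spectrum of any compact geodesic space is discrete in $(0,\infty)$: it has no accumulation point in $(0,\infty)$. -/

import Mathlib

namespace DiscreteHomotopy

variable {X : Type*} [MetricSpace X]

/-- A geodesic space: any two points are joined by an arclength parameterized, distance realizing
curve, i.e. by an isometric image of the interval `[0, dist x y]`. -/
def IsGeodesicSpace (X : Type*) [MetricSpace X] : Prop :=
  ∀ x y : X, ∃ γ : ℝ → X, γ 0 = x ∧ γ (dist x y) = y ∧
    ∀ s ∈ Set.Icc (0 : ℝ) (dist x y), ∀ t ∈ Set.Icc (0 : ℝ) (dist x y),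
      dist (γ s) (γ t) = |s - t|

/-- An `ε`-chain: a finite nonempty sequence of points `x₀, …, xₙ` with consecutive distances
less than `ε`. -/
def IsEpsChain (ε : ℝ) (α : List X) : Prop :=
  α ≠ [] ∧ α.IsChain (fun x y => dist x y < ε)

/-- An `ε`-loop: an `ε`-chain whose first and last points agree. -/
def IsEpsLoop (ε : ℝ) (α : List X) : Prop :=
  IsEpsChain ε α ∧ α.head? = α.getLast?

/-- `β` arises from `α` by adding a single point. -/
def AddsPoint (α β : List X) : Prop :=
  ∃ (l r : List X) (x : X), α = l ++ r ∧ β = l ++ x :: r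

/-- A basic move between `ε`-chains with the same endpoints: add or remove a single point. -/
def BasicMove (ε : ℝ) (α β : List X) : Prop :=
  IsEpsChain ε α ∧ IsEpsChain ε β ∧ α.head? = β.head? ∧ α.getLast? = β.getLast? ∧
    (AddsPoint α β ∨ AddsPoint β α)

/-- `ε`-homotopy of `ε`-chains (with fixed endpoints): a finite sequence of basic moves. -/
def EpsHomotopic (ε : ℝ) (α β : List X) : Prop :=
  IsEpsChain ε α ∧ Relation.ReflTransGen (BasicMove ε) α β

/-- `ε`-null: `ε`-homotopic to a constant chain `{x₀}`.
(Basic moves preserve endpoints, so such a chain is a loop at `x₀`.) -/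
def IsEpsNull (ε : ℝ) (α : List X) : Prop :=
  ∃ x : X, EpsHomotopic ε α [x]

/-- An `ε`-critical `ε`-loop: not `ε`-null, but `δ`-null for every `δ > ε`. -/
def IsEpsCritical (ε : ℝ) (α : List X) : Prop :=
  IsEpsLoop ε α ∧ ¬ IsEpsNull ε α ∧ ∀ δ : ℝ, ε < δ → IsEpsNull δ α

/-- The homotopy critical spectrum: the set of homotopy critical values, that is of all `ε > 0`
for which there is an `ε`-critical `ε`-loop. -/
def criticalSpectrum (X : Type*) [MetricSpace X] : Set ℝ :=
  {ε : ℝ | 0 < ε ∧ ∃ α : List X, IsEpsCritical ε α}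

/-- Concatenation `{x₀, …, xₙ} * {xₙ = y₀, …, yₘ}` (used only when the endpoints match). -/
def concat (α β : List X) : List X := α ++ β.tail

/-- Free `ε`-homotopy of `ε`-loops: there are `ε`-chains `α`, `β` from a common point to the start
of `l₁`, resp. `l₂`, such that `α * l₁ * α⁻¹` is `ε`-homotopic to `β * l₂ * β⁻¹`. -/
def FreelyEpsHomotopic (ε : ℝ) (l₁ l₂ : List X) : Prop :=
  IsEpsLoop ε l₁ ∧ IsEpsLoop ε l₂ ∧
  ∃ α β : List X, IsEpsChain ε α ∧ IsEpsChain ε β ∧ α.head? = β.head? ∧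
    α.getLast? = l₁.head? ∧ β.getLast? = l₂.head? ∧
    EpsHomotopic ε (concat (concat α l₁) α.reverse) (concat (concat β l₂) β.reverse)

/-- `IsMidpointRefinement α β`: the chain `β` is obtained from `α` by inserting a (metric) midpoint
between each point and its successor. -/
inductive IsMidpointRefinement : List X → List X → Prop
  | single (x : X) : IsMidpointRefinement [x] [x]
  | cons (x m y : X) (α β : List X) (hx : dist x m = dist x y / 2) (hy : dist m y = dist x y / 2)
      (h : IsMidpointRefinement (y :: α) β) : IsMidpointRefinement (x :: y :: α) (x :: m :: β)

/-- The sequence `{x₀, x₁, x₂, x₀}` attached to a triple. -/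
def triadLoop (T : X × X × X) : List X := [T.1, T.2.1, T.2.2, T.1]

/-- An `ε`-triad: three points with all mutual distances equal to `ε > 0`. -/
def IsTriad (ε : ℝ) (T : X × X × X) : Prop :=
  0 < ε ∧ dist T.1 T.2.1 = ε ∧ dist T.2.1 T.2.2 = ε ∧ dist T.1 T.2.2 = ε

/-- An essential `ε`-triad: some midpoint refinement of its loop is not `ε`-null. -/
def IsEssentialTriad (ε : ℝ) (T : X × X × X) : Prop :=
  IsTriad ε T ∧ ∃ α : List X, IsMidpointRefinement (triadLoop T) α ∧ ¬ IsEpsNull ε α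

/-- Equivalence of essential `ε`-triads: a midpoint refinement of the loop of `T₁` is freely
`ε`-homotopic to a midpoint refinement of the loop of `T₂` or of its reversal. -/
def TriadEquiv (ε : ℝ) (T₁ T₂ : X × X × X) : Prop :=
  ∃ α β : List X, IsMidpointRefinement (triadLoop T₁) α ∧
    (IsMidpointRefinement (triadLoop T₂) β ∨ IsMidpointRefinement (triadLoop T₂).reverse β) ∧
    FreelyEpsHomotopic ε α β

/-- The multiplicity of `ε`: the number of non-equivalent essential `ε`-triads, that is, the
supremum of the cardinalities of sets of pairwise non-equivalent essential `ε`-triads. -/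
noncomputable def multiplicity (X : Type*) [MetricSpace X] (ε : ℝ) : ℕ∞ :=
  ⨆ S : {S : Set (X × X × X) // (∀ T ∈ S, IsEssentialTriad ε T) ∧
    S.Pairwise (fun T₁ T₂ => ¬ TriadEquiv ε T₁ T₂)}, S.1.encard

/-- The number of homotopy critical values greater than `a`, counted with multiplicity: the
(possibly infinite) sum of the multiplicities of these values, as a supremum of finite sums. -/
noncomputable def criticalCount (X : Type*) [MetricSpace X] (a : ℝ) : ℕ∞ :=
  ⨆ F : {F : Finset ℝ // ∀ ε ∈ F, ε ∈ criticalSpectrum X ∧ a < ε}, ∑ ε ∈ F.1, multiplicity X ε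

/-- A collection of nonempty compact metric spaces is Gromov-Hausdorff precompact if the set of
their isometry classes has compact closure in the Gromov-Hausdorff space. -/
def IsGHPrecompact {ι : Type*} (X : ι → Type*) [∀ i, MetricSpace (X i)]
    [∀ i, CompactSpace (X i)] [∀ i, Nonempty (X i)] : Prop :=
  IsCompact (closure (Set.range fun i => GromovHausdorff.toGHSpace (X i)))

end DiscreteHomotopy

/-! Everything rests on the stability of geodesic triangles at scale `ε`. If two triangles have
sides at most `9/8 * ε` and corresponding vertices less than `ε/8` apart, their midpoint refinements
are freely `ε`-homotopic (`homotopic_triangles`), so one is `ε`-null when the other is. Two close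
triads of equal size are therefore equivalent. Two close essential triads cannot differ in size,
since the smaller one has all sides below the larger scale and is null there. Cut the space into `n`
pieces of diameter less than `a/8` and label a triad by the pieces of its vertices: inequivalent
essential triads of one size, and essential triads of different sizes, all above `a`, get different
labels. This bounds the count by `n ^ 3` (`criticalCount_le`), and Gromov–Hausdorff precompactness
makes `n` uniform.

That multiplicities are at least one, and hence discreteness, needs an essential triad at each
critical value `ε` (`exists_isEssentialTriad`). Midpoint refinement halves steps, so for `δ`
slightly above `ε` a `δ`-homotopy refines to `ε`-chains, and each of its moves becomes an
`ε`-homotopy once the triangle it spans is `ε`-null. A critical loop thus forces non-null triangles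
with sides below `δ` for every such `δ`. As `δ` decreases to `ε` they subconverge to a triangle with
sides at most `ε`, non-null by stability. A side shorter than `ε` would make it null, so the limit
is a triad. -/

namespace DiscreteHomotopy

/-! ### Calculus of `ε`-homotopies: local replacement and elementary moves. -/

section Chains

variable {X : Type*} [MetricSpace X] {ε : ℝ} {α β γ l r : List X}

theorem BasicMove.symm (h : BasicMove ε α β) : BasicMove ε β α :=
  ⟨h.2.1, h.1, h.2.2.1.symm, h.2.2.2.1.symm, h.2.2.2.2.symm⟩

/-- The neighbours of a block constrain only its first and last points. -/
theorem IsEpsChain.congr_append (h : IsEpsChain ε (l ++ α ++ r)) (hα : α ≠ [])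
    (hβ : IsEpsChain ε β) (hh : α.head? = β.head?) (ht : α.getLast? = β.getLast?) :
    IsEpsChain ε (l ++ β ++ r) := by
  refine ⟨by simp [hβ.1], ?_⟩
  have h2 := h.2
  simp only [List.append_assoc, List.isChain_append, List.head?_append_of_ne_nil _ hα,
    List.head?_append_of_ne_nil _ hβ.1] at h2 ⊢
  rw [← hh, ← ht]
  exact ⟨h2.1, ⟨hβ.2, h2.2.1.2⟩, h2.2.2⟩

theorem BasicMove.append (h : BasicMove ε α β) (hc : IsEpsChain ε (l ++ α ++ r)) :
    BasicMove ε (l ++ α ++ r) (l ++ β ++ r) := by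
  obtain ⟨hα, hβ, hh, ht, hadd⟩ := h
  have key : ∀ {α β : List X}, AddsPoint α β → AddsPoint (l ++ α ++ r) (l ++ β ++ r) := by
    rintro _ _ ⟨l', r', x, rfl, rfl⟩
    exact ⟨l ++ l', r' ++ r, x, by simp, by simp⟩
  refine ⟨hc, hc.congr_append hα.1 hβ hh ht, ?_, ?_, hadd.imp key key⟩
  · simp only [List.append_assoc, List.head?_append, hh]
  · simp only [List.append_assoc, List.getLast?_append, ht]

theorem EpsHomotopic.refl (h : IsEpsChain ε α) : EpsHomotopic ε α α := ⟨h, .refl⟩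

theorem EpsHomotopic.trans (h : EpsHomotopic ε α β) (h' : EpsHomotopic ε β γ) :
    EpsHomotopic ε α γ := ⟨h.1, h.2.trans h'.2⟩

theorem BasicMove.homotopic (h : BasicMove ε α β) : EpsHomotopic ε α β := ⟨h.1, .single h⟩

theorem EpsHomotopic.right (h : EpsHomotopic ε α β) : IsEpsChain ε β := by
  obtain ⟨h₁, h₂⟩ := h
  induction h₂ with
  | refl => exact h₁
  | tail _ h _ => exact h.2.1

theorem EpsHomotopic.head?_eq (h : EpsHomotopic ε α β) : α.head? = β.head? := by
  obtain ⟨-, h₂⟩ := h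
  induction h₂ with
  | refl => rfl
  | tail _ h ih => exact ih.trans h.2.2.1

theorem EpsHomotopic.symm (h : EpsHomotopic ε α β) : EpsHomotopic ε β α := by
  refine ⟨h.right, ?_⟩
  obtain ⟨-, h₂⟩ := h
  induction h₂ with
  | refl => exact .refl
  | tail _ h ih => exact .head h.symm ih

theorem EpsHomotopic.append (h : EpsHomotopic ε α β) (l r : List X)
    (hc : IsEpsChain ε (l ++ α ++ r)) : EpsHomotopic ε (l ++ α ++ r) (l ++ β ++ r) := by
  refine ⟨hc, ?_⟩
  obtain ⟨-, h₂⟩ := h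
  induction h₂ with
  | refl => exact .refl
  | tail _ h ih => exact ih.tail (h.append (EpsHomotopic.right ⟨hc, ih⟩))

/-- Replace a piece of a chain by a homotopic piece. -/
theorem EpsHomotopic.replace {α₀ : List X} (l r : List X)
    (h : EpsHomotopic ε α₀ (l ++ α ++ r)) (h' : EpsHomotopic ε α β) :
    EpsHomotopic ε α₀ (l ++ β ++ r) :=
  h.trans (h'.append l r h.right)

theorem EpsHomotopic.insert {a x b : X} (l : List X) (h : EpsHomotopic ε α (l ++ a :: b :: r))
    (hax : dist a x < ε) (hxb : dist x b < ε) : EpsHomotopic ε α (l ++ a :: x :: b :: r) := by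
  have hab : dist a b < ε := by
    have h2 := h.right.2
    rw [List.isChain_append] at h2
    exact (List.isChain_cons_cons.1 h2.2.1).1
  have hm : BasicMove ε [a, b] [a, x, b] := by
    refine ⟨⟨by simp, by simp [hab]⟩, ⟨by simp, by simp [hax, hxb]⟩, by simp, by simp, .inl ?_⟩
    exact ⟨[a], [b], x, rfl, rfl⟩
  have h' : EpsHomotopic ε α (l ++ [a, b] ++ r) := by simpa using h
  simpa using h'.replace l r hm.homotopic

theorem EpsHomotopic.remove {a x b : X} (l : List X)
    (h : EpsHomotopic ε α (l ++ a :: x :: b :: r)) (hab : dist a b < ε) :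
    EpsHomotopic ε α (l ++ a :: b :: r) := by
  have h2 := h.right.2
  rw [List.isChain_append] at h2
  have h3 := List.isChain_cons_cons.1 h2.2.1
  have h4 := List.isChain_cons_cons.1 h3.2
  have hm : BasicMove ε [a, x, b] [a, b] := by
    refine ⟨⟨by simp, by simp [h3.1, h4.1]⟩, ⟨by simp, by simp [hab]⟩, by simp, by simp, .inr ?_⟩
    exact ⟨[a], [b], x, rfl, rfl⟩
  have h' : EpsHomotopic ε α (l ++ [a, x, b] ++ r) := by simpa using h
  simpa using h'.replace l r hm.homotopic

theorem homotopic_pair_self (hε : 0 < ε) (x : X) : EpsHomotopic ε [x, x] [x] :=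
  BasicMove.homotopic ⟨⟨by simp, by simp [hε]⟩, ⟨by simp, by simp⟩, rfl, rfl,
    .inr ⟨[], [x], x, rfl, rfl⟩⟩

/-- Collapse a repeated point. -/
theorem EpsHomotopic.dedup {x : X} (hε : 0 < ε) (l : List X)
    (h : EpsHomotopic ε α (l ++ x :: x :: r)) : EpsHomotopic ε α (l ++ x :: r) := by
  have h' : EpsHomotopic ε α (l ++ [x, x] ++ r) := by simpa using h
  simpa using h'.replace l r (homotopic_pair_self hε x)

/-- Duplicate a point. -/
theorem EpsHomotopic.dup {x : X} (hε : 0 < ε) (l : List X)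
    (h : EpsHomotopic ε α (l ++ x :: r)) : EpsHomotopic ε α (l ++ x :: x :: r) := by
  have h' : EpsHomotopic ε α (l ++ [x] ++ r) := by simpa using h
  simpa using h'.replace l r (homotopic_pair_self hε x).symm

/-- Collapse a backtracking step. -/
theorem EpsHomotopic.backtrack {x y : X} (hε : 0 < ε) (l : List X)
    (h : EpsHomotopic ε α (l ++ x :: y :: x :: r)) : EpsHomotopic ε α (l ++ x :: r) :=
  (h.remove l (by simpa using hε)).dedup hε l

/-- Create a backtracking step. -/
theorem EpsHomotopic.unbacktrack {x y : X} (hε : 0 < ε) (l : List X)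
    (h : EpsHomotopic ε α (l ++ x :: r)) (hxy : dist x y < ε) :
    EpsHomotopic ε α (l ++ x :: y :: x :: r) :=
  (h.dup hε l).insert l hxy (by rwa [dist_comm])

theorem IsEpsNull.homotopic_head {x : X} (h : IsEpsNull ε (x :: α)) :
    EpsHomotopic ε (x :: α) [x] := by
  obtain ⟨y, hy⟩ := h
  have := hy.head?_eq
  simp only [List.head?_cons, Option.some.injEq] at this
  rwa [this] at hy ⊢

end Chains

/-! ### Stability and nullity of refined geodesic triangles. -/

section Triangles

variable {X : Type*} [MetricSpace X] {ε : ℝ}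

/-- `m` is a metric midpoint of `x` and `y`. -/
def IsMetricMidpoint (x m y : X) : Prop :=
  dist x m = dist x y / 2 ∧ dist m y = dist x y / 2

theorem IsGeodesicSpace.exists_between (hX : IsGeodesicSpace X) (x y : X) {t : ℝ} (ht₀ : 0 ≤ t)
    (ht₁ : t ≤ 1) : ∃ z, dist x z = t * dist x y ∧ dist z y = (1 - t) * dist x y := by
  obtain ⟨γ, h0, h1, hγ⟩ := hX x y
  have hd : (0 : ℝ) ≤ dist x y := dist_nonneg
  have hm : t * dist x y ∈ Set.Icc (0 : ℝ) (dist x y) := ⟨by positivity, by nlinarith⟩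
  refine ⟨γ (t * dist x y), ?_, ?_⟩
  · have := hγ 0 ⟨le_rfl, hd⟩ _ hm
    rw [h0] at this
    rw [this, zero_sub, abs_neg, abs_of_nonneg hm.1]
  · have := hγ _ hm (dist x y) ⟨hd, le_rfl⟩
    rw [h1] at this
    rw [this, abs_of_nonpos (by linarith [hm.2])]
    ring

theorem IsGeodesicSpace.exists_midpoint (hX : IsGeodesicSpace X) (x y : X) :
    ∃ m, IsMetricMidpoint x m y := by
  obtain ⟨m, h1, h2⟩ := hX.exists_between x y (t := 1 / 2) (by norm_num) (by norm_num)
  exact ⟨m, by linarith, by linarith⟩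

theorem isMidpointRefinement_triadLoop_iff {T : X × X × X} {β : List X} :
    IsMidpointRefinement (triadLoop T) β ↔ ∃ m₀ m₁ m₂, IsMetricMidpoint T.1 m₀ T.2.1 ∧
      IsMetricMidpoint T.2.1 m₁ T.2.2 ∧ IsMetricMidpoint T.2.2 m₂ T.1 ∧
      β = [T.1, m₀, T.2.1, m₁, T.2.2, m₂, T.1] := by
  constructor
  · intro h
    rcases h with _ | ⟨_, m₀, _, _, _, a₀, b₀, h⟩
    rcases h with _ | ⟨_, m₁, _, _, _, a₁, b₁, h⟩
    rcases h with _ | ⟨_, m₂, _, _, _, a₂, b₂, h⟩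
    rcases h with _ | _
    exact ⟨m₀, m₁, m₂, ⟨a₀, b₀⟩, ⟨a₁, b₁⟩, ⟨a₂, b₂⟩, rfl⟩
  · rintro ⟨m₀, m₁, m₂, ⟨a₀, b₀⟩, ⟨a₁, b₁⟩, ⟨a₂, b₂⟩, rfl⟩
    exact .cons _ _ _ _ _ a₀ b₀ (.cons _ _ _ _ _ a₁ b₁ (.cons _ _ _ _ _ a₂ b₂ (.single _)))

/-- Two geodesic segments of length about `ε` with nearby endpoints are `ε`-homotopic. -/
theorem homotopic_segments (hX : IsGeodesicSpace X) (hε : 0 < ε) {x m y x' m' y' : X}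
    (hm : IsMetricMidpoint x m y) (hm' : IsMetricMidpoint x' m' y') (hxy : dist x y ≤ 9 / 8 * ε)
    (hxy' : dist x' y' ≤ 9 / 8 * ε) (hx : dist x x' < ε / 8) (hy : dist y y' < ε / 8) :
    EpsHomotopic ε [x, m, y] [x, x', m', y', y] := by
  -- The homotopy passes through the three-quarter points `u`, `u'`. The tightest step is from `x`
  -- to `u'`, bounded by `3/4 * 9/8 * ε + ε/8 = 31/32 * ε`; this is what the constants `9/8` and
  -- `1/8` allow.
  obtain ⟨u, hu₁, hu₂⟩ := hX.exists_midpoint m y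
  obtain ⟨u', hu₁', hu₂'⟩ := hX.exists_midpoint m' y'
  obtain ⟨hm₁, hm₂⟩ := hm
  obtain ⟨hm₁', hm₂'⟩ := hm'
  have t₁ := dist_triangle x m u
  have t₂ := dist_triangle x' m' u'
  have t₃ := dist_triangle u y y'
  have t₄ := dist_triangle u y' u'
  have t₅ := dist_triangle x x' u'
  have c₁ := dist_comm y y'
  have c₂ := dist_comm y' u'
  have s₀ : EpsHomotopic ε [x, m, y] [x, m, y] :=
    .refl ⟨by simp, by simp; constructor <;> linarith⟩
  have s₁ : EpsHomotopic ε [x, m, y] [x, m, u, y] :=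
    s₀.insert [x] (by linarith) (by linarith)
  have s₂ : EpsHomotopic ε [x, m, y] [x, u, y] := s₁.remove [] (by linarith)
  have s₃ : EpsHomotopic ε [x, m, y] [x, u, y', y] :=
    s₂.insert [x] (by linarith) (by linarith)
  have s₄ : EpsHomotopic ε [x, m, y] [x, u, u', y', y] :=
    s₃.insert [x] (by linarith) (by linarith)
  have s₅ : EpsHomotopic ε [x, m, y] [x, u', y', y] := s₄.remove [] (by linarith)
  have s₆ : EpsHomotopic ε [x, m, y] [x, x', u', y', y] :=
    s₅.insert [] (by linarith) (by linarith)
  have s₇ : EpsHomotopic ε [x, m, y] [x, x', m', u', y', y] :=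
    s₆.insert [x] (by linarith) (by linarith)
  exact s₇.remove [x, x'] (by linarith)

theorem isEpsChain_triangle {x y z m₀ m₁ m₂ : X} (h₀ : IsMetricMidpoint x m₀ y)
    (h₁ : IsMetricMidpoint y m₁ z) (h₂ : IsMetricMidpoint z m₂ x) (hxy : dist x y < 2 * ε)
    (hyz : dist y z < 2 * ε) (hzx : dist z x < 2 * ε) :
    IsEpsChain ε [x, m₀, y, m₁, z, m₂, x] := by
  refine ⟨by simp, ?_⟩
  simp only [List.isChain_cons_cons, List.isChain_singleton, and_true, h₀.1, h₀.2, h₁.1, h₁.2,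
    h₂.1, h₂.2]
  refine ⟨?_, ?_, ?_, ?_, ?_, ?_⟩ <;> linarith

/-- Refinements of nearby geodesic triangles of side about `ε` are freely `ε`-homotopic. -/
theorem homotopic_triangles (hX : IsGeodesicSpace X) (hε : 0 < ε)
    {x y z m₀ m₁ m₂ x' y' z' m₀' m₁' m₂' : X} (h₀ : IsMetricMidpoint x m₀ y)
    (h₁ : IsMetricMidpoint y m₁ z) (h₂ : IsMetricMidpoint z m₂ x)
    (h₀' : IsMetricMidpoint x' m₀' y') (h₁' : IsMetricMidpoint y' m₁' z')
    (h₂' : IsMetricMidpoint z' m₂' x') (hxy : dist x y ≤ 9 / 8 * ε) (hyz : dist y z ≤ 9 / 8 * ε)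
    (hzx : dist z x ≤ 9 / 8 * ε) (hxy' : dist x' y' ≤ 9 / 8 * ε) (hyz' : dist y' z' ≤ 9 / 8 * ε)
    (hzx' : dist z' x' ≤ 9 / 8 * ε) (hx : dist x x' < ε / 8) (hy : dist y y' < ε / 8)
    (hz : dist z z' < ε / 8) :
    EpsHomotopic ε [x, m₀, y, m₁, z, m₂, x] [x, x', m₀', y', m₁', z', m₂', x', x] := by
  have s₀ := EpsHomotopic.refl (isEpsChain_triangle (ε := ε) h₀ h₁ h₂ (by linarith) (by linarith)
    (by linarith))
  have s₁ := s₀.replace (α := [x, m₀, y]) [] [m₁, z, m₂, x]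
    (homotopic_segments hX hε h₀ h₀' hxy hxy' hx hy)
  have s₂ := s₁.replace (α := [y, m₁, z]) [x, x', m₀', y'] [m₂, x]
    (homotopic_segments hX hε h₁ h₁' hyz hyz' hy hz)
  have s₃ := s₂.replace (α := [z, m₂, x]) [x, x', m₀', y', y, y', m₁', z'] []
    (homotopic_segments hX hε h₂ h₂' hzx hzx' hz hx)
  have s₄ : EpsHomotopic ε [x, m₀, y, m₁, z, m₂, x]
      [x, x', m₀', y', m₁', z', z, z', m₂', x', x] :=
    EpsHomotopic.backtrack hε [x, x', m₀'] s₃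
  exact EpsHomotopic.backtrack hε [x, x', m₀', y', m₁'] s₄

/-- Nullity of the refinement of a geodesic triangle passes to nearby triangles. -/
theorem isEpsNull_of_close_triangle (hX : IsGeodesicSpace X) (hε : 0 < ε)
    {x y z m₀ m₁ m₂ x' y' z' m₀' m₁' m₂' : X} (h₀ : IsMetricMidpoint x m₀ y)
    (h₁ : IsMetricMidpoint y m₁ z) (h₂ : IsMetricMidpoint z m₂ x)
    (h₀' : IsMetricMidpoint x' m₀' y') (h₁' : IsMetricMidpoint y' m₁' z')
    (h₂' : IsMetricMidpoint z' m₂' x') (hxy : dist x y ≤ 9 / 8 * ε) (hyz : dist y z ≤ 9 / 8 * ε)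
    (hzx : dist z x ≤ 9 / 8 * ε) (hxy' : dist x' y' ≤ 9 / 8 * ε) (hyz' : dist y' z' ≤ 9 / 8 * ε)
    (hzx' : dist z' x' ≤ 9 / 8 * ε) (hx : dist x x' < ε / 8) (hy : dist y y' < ε / 8)
    (hz : dist z z' < ε / 8) (hnull : IsEpsNull ε [x', m₀', y', m₁', z', m₂', x']) :
    IsEpsNull ε [x, m₀, y, m₁, z, m₂, x] := by
  have s₁ := homotopic_triangles hX hε h₀ h₁ h₂ h₀' h₁' h₂' hxy hyz hzx hxy' hyz' hzx' hx hy hz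
  have s₂ : EpsHomotopic ε [x, m₀, y, m₁, z, m₂, x] [x, x', x] :=
    EpsHomotopic.replace (α := [x', m₀', y', m₁', z', m₂', x']) [x] [x] s₁ hnull.homotopic_head
  exact ⟨x, s₂.backtrack hε []⟩

/-- A triangle all of whose sides are shorter than `ε` has `ε`-null refinements. -/
theorem isEpsNull_of_small_triangle (hε : 0 < ε) {x y z m₀ m₁ m₂ : X}
    (h₀ : IsMetricMidpoint x m₀ y) (h₁ : IsMetricMidpoint y m₁ z) (h₂ : IsMetricMidpoint z m₂ x)
    (hxy : dist x y < ε) (hyz : dist y z < ε) (hzx : dist z x < ε) :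
    IsEpsNull ε [x, m₀, y, m₁, z, m₂, x] := by
  have s₀ := EpsHomotopic.refl (isEpsChain_triangle (ε := ε) h₀ h₁ h₂ (by linarith) (by linarith)
    (by linarith))
  have s₁ : EpsHomotopic ε _ [x, y, m₁, z, m₂, x] := s₀.remove [] hxy
  have s₂ : EpsHomotopic ε _ [x, y, z, m₂, x] := s₁.remove [x] hyz
  have s₃ : EpsHomotopic ε _ [x, y, z, x] := s₂.remove [x, y] hzx
  have s₄ : EpsHomotopic ε _ [x, z, x] := s₃.remove [] (by rwa [dist_comm])
  exact ⟨x, s₄.backtrack hε []⟩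

/-- A triangle with sides at most `ε`, one of them shorter, has `ε`-null refinements. -/
theorem isEpsNull_of_short_side (hX : IsGeodesicSpace X) (hε : 0 < ε) {x y z m₀ m₁ m₂ : X}
    (h₀ : IsMetricMidpoint x m₀ y) (h₁ : IsMetricMidpoint y m₁ z) (h₂ : IsMetricMidpoint z m₂ x)
    (hxy : dist x y < ε) (hyz : dist y z ≤ ε) (hzx : dist z x ≤ ε) :
    IsEpsNull ε [x, m₀, y, m₁, z, m₂, x] := by
  -- With this `t`, `dist x y = ε - 2 * t * ε`. Moving `x` and `y` towards `z` by at most `t * ε /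
  -- 2` each keeps the new points `x'`, `y'` less than `ε` apart, and brings both strictly within
  -- `ε` of `z`, so `z` can be removed.
  set t : ℝ := (ε - dist x y) / (2 * ε) with ht
  have ht₀ : 0 < t := by have := sub_pos.2 hxy; positivity
  have ht₁ : t ≤ 1 / 2 := by
    rw [ht, div_le_iff₀ (by positivity)]
    linarith [dist_nonneg (x := x) (y := y)]
  have htε : t * ε = (ε - dist x y) / 2 := by rw [ht]; field_simp
  obtain ⟨x', hx₁, hx₂⟩ := hX.exists_between x m₂ ht₀.le (by linarith)
  obtain ⟨y', hy₁, hy₂⟩ := hX.exists_between y m₁ ht₀.le (by linarith)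
  have a₁ : dist x m₂ = dist z x / 2 := by rw [dist_comm, h₂.2]
  have a₂ : dist m₂ z = dist z x / 2 := by rw [dist_comm, h₂.1]
  rw [a₁] at hx₁ hx₂
  rw [h₁.1] at hy₁ hy₂
  have b₁ : t * dist z x ≤ t * ε := by gcongr
  have b₂ : t * dist y z ≤ t * ε := by gcongr
  have b₃ : (1 - t) * dist z x ≤ (1 - t) * ε := mul_le_mul_of_nonneg_left hzx (by linarith)
  have b₄ : (1 - t) * dist y z ≤ (1 - t) * ε := mul_le_mul_of_nonneg_left hyz (by linarith)
  have tε : 0 < t * ε := by positivity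
  have c₁ : dist z x' ≤ dist z m₂ + dist m₂ x' := dist_triangle _ _ _
  have c₂ : dist y' z ≤ dist y' m₁ + dist m₁ z := dist_triangle _ _ _
  have c₃ : dist y' x' ≤ dist y' y + dist y x + dist x x' := dist_triangle4 _ _ _ _
  have c₄ : dist y x' ≤ dist y x + dist x x' := dist_triangle _ _ _
  have d₀ : 0 ≤ dist x y := dist_nonneg
  have e₁ := dist_comm m₂ x'
  have e₂ := dist_comm y' y
  have e₃ := dist_comm y x
  have e₄ := dist_comm x' x
  have e₅ := h₁.2
  have e₆ := h₂.1
  have s₀ := EpsHomotopic.refl (isEpsChain_triangle (ε := ε) h₀ h₁ h₂ (by linarith) (by linarith)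
    (by linarith))
  have s₁ : EpsHomotopic ε _ [x, y, m₁, z, m₂, x] := s₀.remove [] hxy
  have s₂ : EpsHomotopic ε _ [x, y, y', m₁, z, m₂, x] :=
    s₁.insert [x] (by linarith) (by linarith)
  have s₃ : EpsHomotopic ε _ [x, y, y', z, m₂, x] := s₂.remove [x, y] (by linarith)
  have s₄ : EpsHomotopic ε _ [x, y, y', z, m₂, x', x] :=
    s₃.insert [x, y, y', z] (by linarith) (by linarith)
  have s₅ : EpsHomotopic ε _ [x, y, y', z, x', x] := s₄.remove [x, y, y'] (by linarith)
  have s₆ : EpsHomotopic ε _ [x, y, y', x', x] := s₅.remove [x, y] (by linarith)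
  have s₇ : EpsHomotopic ε _ [x, y, x', x] := s₆.remove [x] (by linarith)
  have s₈ : EpsHomotopic ε _ [x, x', x] := s₇.remove [] (by linarith)
  exact ⟨x, s₈.backtrack hε []⟩

/-- Up to backtracking, the loop based at `x` is the loop based at `y` conjugated by the path `x,
m₀, y`. -/
theorem isEpsNull_rotate (hε : 0 < ε) {x y z m₀ m₁ m₂ : X}
    (h : IsEpsNull ε [y, m₁, z, m₂, x, m₀, y]) (hx : dist x m₀ < ε) (hy : dist m₀ y < ε) :
    IsEpsNull ε [x, m₀, y, m₁, z, m₂, x] := by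
  have hc := h.homotopic_head.1.2
  simp only [List.isChain_cons_cons, List.isChain_singleton, and_true] at hc
  have s₀ : EpsHomotopic ε [x, m₀, y, m₁, z, m₂, x] [x, m₀, y, m₁, z, m₂, x] :=
    .refl ⟨by simp, by simp [hx, hy, hc]⟩
  have s₁ : EpsHomotopic ε _ [x, m₀, y, m₁, z, m₂, x, m₀, x] :=
    s₀.unbacktrack hε [x, m₀, y, m₁, z, m₂] hx
  have s₂ : EpsHomotopic ε _ [x, m₀, y, m₁, z, m₂, x, m₀, y, m₀, x] :=
    s₁.unbacktrack hε [x, m₀, y, m₁, z, m₂, x] hy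
  have s₃ : EpsHomotopic ε _ [x, m₀, y, m₀, x] :=
    s₂.replace (α := [y, m₁, z, m₂, x, m₀, y]) [x, m₀] [m₀, x] h.homotopic_head
  have s₄ : EpsHomotopic ε _ [x, m₀, x] := s₃.backtrack hε [x]
  exact ⟨x, s₄.backtrack hε []⟩

/-- A triangle with sides at most `ε` and a non-null refinement is a triad. -/
theorem isTriad_of_not_isEpsNull (hX : IsGeodesicSpace X) (hε : 0 < ε) {x y z m₀ m₁ m₂ : X}
    (h₀ : IsMetricMidpoint x m₀ y) (h₁ : IsMetricMidpoint y m₁ z) (h₂ : IsMetricMidpoint z m₂ x)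
    (hxy : dist x y ≤ ε) (hyz : dist y z ≤ ε) (hzx : dist z x ≤ ε)
    (hn : ¬ IsEpsNull ε [x, m₀, y, m₁, z, m₂, x]) : IsTriad ε (x, y, z) := by
  have h₀₁ := h₀.1
  have h₀₂ := h₀.2
  have h₁₁ := h₁.1
  have h₁₂ := h₁.2
  -- A side shorter than `ε`, rotated into first position, would make the loop null.
  refine ⟨hε, hxy.antisymm ?_, hyz.antisymm ?_, (dist_comm x z ▸ hzx).antisymm ?_⟩ <;>
    refine not_lt.1 fun hlt => hn ?_
  · exact isEpsNull_of_short_side hX hε h₀ h₁ h₂ hlt hyz hzx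
  · exact isEpsNull_rotate hε (isEpsNull_of_short_side hX hε h₁ h₂ h₀ hlt hzx hxy)
      (by linarith) (by linarith)
  · refine isEpsNull_rotate hε (isEpsNull_rotate hε (isEpsNull_of_short_side hX hε h₂ h₀ h₁
      (by rwa [dist_comm]) hxy hyz) ?_ ?_) ?_ ?_ <;> linarith

end Triangles

/-! ### Refinement of lists by a fixed choice of midpoints. -/

section RefineList

variable {X : Type*}

/-- Insert `mid x y` between any two consecutive points `x`, `y` of a list. -/
def refine (mid : X → X → X) : List X → List X
  | [] => []
  | [x] => [x]
  | x :: y :: l => x :: mid x y :: refine mid (y :: l)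

variable {mid : X → X → X}

theorem exists_refine_cons (x : X) (l : List X) : ∃ l', refine mid (x :: l) = x :: l' := by
  cases l <;> exact ⟨_, rfl⟩

theorem exists_refine_concat (l : List X) (x : X) : ∃ l', refine mid (l ++ [x]) = l' ++ [x] := by
  induction l with
  | nil => exact ⟨[], rfl⟩
  | cons a l ih =>
    obtain ⟨l', hl'⟩ := ih
    cases l with
    | nil => exact ⟨[a, mid a x], rfl⟩
    | cons b l => exact ⟨a :: mid a b :: l', by simpa [refine] using hl'⟩

theorem refine_append (l r : List X) (a b : X) :
    refine mid (l ++ a :: b :: r) = refine mid (l ++ [a]) ++ mid a b :: refine mid (b :: r) := by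
  induction l with
  | nil => simp [refine]
  | cons c l ih =>
    cases l with
    | nil => simp [refine]
    | cons d l => simpa [refine] using ih

end RefineList

/-! ### From critical loops to essential triads. -/

section Refinement

variable {X : Type*} [MetricSpace X] {ε δ : ℝ}

variable {mid : X → X → X}

theorem isEpsChain_refine (hmid : ∀ x y, IsMetricMidpoint x (mid x y) y) (hδ : δ < 2 * ε)
    {α : List X} (hα : IsEpsChain δ α) : IsEpsChain ε (refine mid α) := by
  obtain ⟨hne, hα⟩ := hα
  induction α with
  | nil => exact absurd rfl hne
  | cons x α ih =>
    cases α with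
    | nil => exact ⟨by simp [refine], by simp [refine]⟩
    | cons y α =>
      rw [List.isChain_cons_cons] at hα
      have h := (ih (by simp) hα.2).2
      obtain ⟨l, hl⟩ := exists_refine_cons (mid := mid) y α
      have h₁ := (hmid x y).1
      have h₂ := (hmid x y).2
      refine ⟨by simp [refine], ?_⟩
      rw [refine, hl, List.isChain_cons_cons, List.isChain_cons_cons, ← hl]
      exact ⟨by linarith, by linarith, h⟩

theorem homotopic_refine (hε : 0 < ε) (hmid : ∀ x y, IsMetricMidpoint x (mid x y) y) {α : List X}
    (hα : IsEpsChain ε α) : EpsHomotopic ε α (refine mid α) := by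
  obtain ⟨hne, hα⟩ := hα
  induction α with
  | nil => exact absurd rfl hne
  | cons x α ih =>
    cases α with
    | nil => exact .refl ⟨by simp, hα⟩
    | cons y α =>
      have hxy := (List.isChain_cons_cons.1 hα).1
      have h := ih (by simp) (List.isChain_cons_cons.1 hα).2
      obtain ⟨l, hl⟩ := exists_refine_cons (mid := mid) y α
      have s₀ : EpsHomotopic ε (x :: y :: α) ([x] ++ (y :: α) ++ []) := by
        simpa using EpsHomotopic.refl (α := x :: y :: α) ⟨by simp, hα⟩
      have s₁ := s₀.replace [x] [] h
      have h₁ := (hmid x y).1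
      have h₂ := (hmid x y).2
      rw [hl] at s₁
      rw [refine, hl]
      simp only [List.append_nil] at s₁
      exact s₁.insert [] (by linarith) (by linarith)

/-- If a geodesic triangle has an `ε`-null refinement, then the refinement of one of its sides is
`ε`-homotopic to the refinement of the union of the other two. -/
theorem homotopic_of_isEpsNull_triangle (hε : 0 < ε) {a x b m₀ m₁ m₂ m : X}
    (hn : IsEpsNull ε [a, m₀, x, m₁, b, m₂, a]) (hm : IsMetricMidpoint a m b)
    (hab : dist a b < 2 * ε) (h : EpsHomotopic ε [b, m₂, a] [b, m, a]) :
    EpsHomotopic ε [a, m, b] [a, m₀, x, m₁, b] := by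
  have h₁ := hm.1
  have h₂ := hm.2
  have t₀ := hn.homotopic_head.symm
  have t₁ : EpsHomotopic ε [a] [a, m₀, x, m₁, b, m, a] :=
    t₀.replace (α := [b, m₂, a]) [a, m₀, x, m₁] [] h
  have s₀ : EpsHomotopic ε [a, m, b] [a, m, b] :=
    .refl ⟨by simp, by simp; constructor <;> linarith⟩
  -- Splice the null triangle in at `a`; its closing side then cancels against the original path `a,
  -- m, b`.
  have s₁ : EpsHomotopic ε [a, m, b] [a, m₀, x, m₁, b, m, a, m, b] :=
    s₀.replace (α := [a]) [] [m, b] t₁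
  have s₂ : EpsHomotopic ε [a, m, b] [a, m₀, x, m₁, b, m, b] :=
    s₁.backtrack hε [a, m₀, x, m₁, b]
  exact s₂.backtrack hε [a, m₀, x, m₁]

/-- A point added in the interior replaces one refined side of a triangle by the other two, which
`htri` handles. A point added at an end must repeat the endpoint, because endpoints are fixed. -/
theorem homotopic_refine_of_addsPoint (hε : 0 < ε)
    (hmid : ∀ x y, IsMetricMidpoint x (mid x y) y) (hδ : δ < 2 * ε)
    (htri : ∀ a x b, dist a x < δ → dist x b < δ → dist a b < δ →
      EpsHomotopic ε [a, mid a b, b] [a, mid a x, x, mid x b, b])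
    {α β : List X} (hα : IsEpsChain δ α) (hβ : IsEpsChain δ β) (hh : α.head? = β.head?)
    (ht : α.getLast? = β.getLast?) (hadd : AddsPoint α β) :
    EpsHomotopic ε (refine mid α) (refine mid β) := by
  have hself : ∀ x, mid x x = x := fun x => by
    have := (hmid x x).1
    rw [dist_self, zero_div] at this
    exact (dist_eq_zero.1 this).symm
  obtain ⟨l, r, x, rfl, rfl⟩ := hadd
  have hrα := EpsHomotopic.refl (isEpsChain_refine hmid hδ hα)
  rcases l.eq_nil_or_concat' with rfl | ⟨l, a, rfl⟩
  · cases r with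
    | nil => exact absurd rfl hα.1
    | cons b r =>
      obtain rfl : b = x := by simpa using hh
      obtain ⟨l', hl'⟩ := exists_refine_cons (mid := mid) b r
      simp only [List.nil_append] at hrα ⊢
      rw [refine, hself, hl']
      rw [hl'] at hrα
      exact (hrα.dup hε []).dup hε []
  · cases r with
    | nil =>
      obtain rfl : a = x := by simpa using ht
      obtain ⟨l', hl'⟩ := exists_refine_concat (mid := mid) l a
      simp only [List.append_assoc, List.append_nil, List.cons_append, List.nil_append]
        at hrα ⊢
      rw [refine_append, hself, hl']
      rw [hl'] at hrα
      simpa [refine] using (hrα.dup hε l').dup hε l'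
    | cons b r =>
      obtain ⟨l', hl'⟩ := exists_refine_concat (mid := mid) l a
      obtain ⟨r', hr'⟩ := exists_refine_cons (mid := mid) b r
      have hα₂ := hα.2
      have hβ₂ := hβ.2
      simp only [List.append_assoc, List.cons_append, List.nil_append, List.isChain_append,
        List.isChain_cons_cons] at hα₂ hβ₂ hrα ⊢
      have e : refine mid (l ++ a :: x :: b :: r)
          = l' ++ [a, mid a x, x, mid x b, b] ++ r' := by
        rw [refine_append, refine, hl', hr']
        simp
      have e' : refine mid (l ++ a :: b :: r) = l' ++ [a, mid a b, b] ++ r' := by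
        rw [refine_append, hl', hr']
        simp
      rw [e]
      rw [e'] at hrα ⊢
      exact hrα.replace l' r' (htri a x b hβ₂.2.1.1 hβ₂.2.1.2.1 hα₂.2.1.1)

/-- If all geodesic triangles of side less than `δ < 2ε` have `ε`-null refinements, then `δ`-null
`ε`-chains are `ε`-null. -/
theorem isEpsNull_of_isEpsNull_of_triangles (hX : IsGeodesicSpace X) (hε : 0 < ε)
    (hδ : δ ≤ 9 / 8 * ε)
    (htri : ∀ x y z m₀ m₁ m₂ : X, IsMetricMidpoint x m₀ y → IsMetricMidpoint y m₁ z →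
      IsMetricMidpoint z m₂ x → dist x y < δ → dist y z < δ → dist z x < δ →
      IsEpsNull ε [x, m₀, y, m₁, z, m₂, x])
    {α : List X} (hα : IsEpsChain ε α) (hn : IsEpsNull δ α) : IsEpsNull ε α := by
  choose mid hmid using fun x y => hX.exists_midpoint x y
  have hside : ∀ a x b, dist a x < δ → dist x b < δ → dist a b < δ →
      EpsHomotopic ε [a, mid a b, b] [a, mid a x, x, mid x b, b] := by
    intro a x b hax hxb hab
    -- The choice `mid` need not be symmetric; closing the triangle with `mid a b` makes the
    -- required homotopy of return sides trivial.
    have hm : IsMetricMidpoint b (mid a b) a :=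
      ⟨by rw [dist_comm, (hmid a b).2, dist_comm a b],
        by rw [dist_comm, (hmid a b).1, dist_comm a b]⟩
    have hba : dist b a < δ := by rwa [dist_comm]
    refine homotopic_of_isEpsNull_triangle hε
      (htri a x b _ _ (mid a b) (hmid _ _) (hmid _ _) hm hax hxb hba) (hmid a b)
      (by linarith) (.refl ⟨by simp, ?_⟩)
    simp only [List.isChain_cons_cons, List.isChain_singleton, and_true, hm.1, hm.2]
    constructor <;> linarith
  have hδ' : δ < 2 * ε := by linarith
  obtain ⟨x, hc, hx⟩ := hn
  refine ⟨x, (homotopic_refine hε hmid hα).trans ?_⟩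
  suffices ∀ β, Relation.ReflTransGen (BasicMove δ) α β →
      EpsHomotopic ε (refine mid α) (refine mid β) from this [x] hx
  intro β hβ
  induction hβ with
  | refl => exact .refl (isEpsChain_refine hmid hδ' hc)
  | tail _ h ih =>
    obtain ⟨h₁, h₂, hh, ht, h | h⟩ := h
    · exact ih.trans (homotopic_refine_of_addsPoint hε hmid hδ' hside h₁ h₂ hh ht h)
    · exact ih.trans
        (homotopic_refine_of_addsPoint hε hmid hδ' hside h₂ h₁ hh.symm ht.symm h).symm

open Filter Topology in
/-- In a compact geodesic space, every homotopy critical value is the size of an essential triad. -/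
theorem exists_isEssentialTriad [CompactSpace X] (hX : IsGeodesicSpace X)
    (hε : ε ∈ criticalSpectrum X) : ∃ T : X × X × X, IsEssentialTriad ε T := by
  obtain ⟨hε, α, hα, hnn, hnull⟩ := hε
  -- The scales decrease to `ε` while staying at most `9/8 * ε`, as the stability lemmas require.
  -- Were all triangles at one scale null, the critical loop would be too.
  have key : ∀ n : ℕ, ∃ T : X × X × X, (dist T.1 T.2.1 < ε + ε / 8 / (n + 1) ∧
      dist T.2.1 T.2.2 < ε + ε / 8 / (n + 1) ∧ dist T.2.2 T.1 < ε + ε / 8 / (n + 1)) ∧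
      ∃ m₀ m₁ m₂, IsMetricMidpoint T.1 m₀ T.2.1 ∧ IsMetricMidpoint T.2.1 m₁ T.2.2 ∧
        IsMetricMidpoint T.2.2 m₂ T.1 ∧
        ¬ IsEpsNull ε [T.1, m₀, T.2.1, m₁, T.2.2, m₂, T.1] := by
    intro n
    by_contra! hcon
    have hle : ε / 8 / (n + 1) ≤ ε / 8 := div_le_self (by positivity) (by simp)
    have hpos : 0 < ε / 8 / ((n : ℝ) + 1) := by positivity
    refine hnn (isEpsNull_of_isEpsNull_of_triangles hX hε (δ := ε + ε / 8 / (n + 1))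
      (by linarith) ?_ hα.1 (hnull _ (by linarith)))
    intro x y z m₀ m₁ m₂ h₀ h₁ h₂ hxy hyz hzx
    exact hcon (x, y, z) ⟨hxy, hyz, hzx⟩ m₀ m₁ m₂ h₀ h₁ h₂
  choose T hT m₀ m₁ m₂ h₀ h₁ h₂ hTn using key
  obtain ⟨⟨x, y, z⟩, φ, hφ, hlim⟩ := CompactSpace.tendsto_subseq T
  have lx : Tendsto (fun n => (T (φ n)).1) atTop (𝓝 x) := (continuous_fst.tendsto _).comp hlim
  have lyz : Tendsto (fun n => (T (φ n)).2) atTop (𝓝 (y, z)) :=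
    (continuous_snd.tendsto _).comp hlim
  have ly : Tendsto (fun n => (T (φ n)).2.1) atTop (𝓝 y) := (continuous_fst.tendsto _).comp lyz
  have lz : Tendsto (fun n => (T (φ n)).2.2) atTop (𝓝 z) := (continuous_snd.tendsto _).comp lyz
  have lε : Tendsto (fun n => ε + ε / 8 / ((φ n : ℝ) + 1)) atTop (𝓝 ε) := by
    have h : Tendsto (fun n : ℕ => ε + ε / 8 / ((n : ℝ) + 1)) atTop (𝓝 (ε + 0)) :=
      tendsto_const_nhds.add
        (tendsto_const_nhds.div_atTop (tendsto_natCast_atTop_atTop.atTop_add tendsto_const_nhds))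
    rw [add_zero] at h
    exact h.comp hφ.tendsto_atTop
  have hxy : dist x y ≤ ε := le_of_tendsto_of_tendsto' (lx.dist ly) lε fun n => (hT _).1.le
  have hyz : dist y z ≤ ε := le_of_tendsto_of_tendsto' (ly.dist lz) lε fun n => (hT _).2.1.le
  have hzx : dist z x ≤ ε := le_of_tendsto_of_tendsto' (lz.dist lx) lε fun n => (hT _).2.2.le
  obtain ⟨n, hnx, hny, hnz⟩ := ((Metric.tendsto_nhds.1 lx _ (show 0 < ε / 8 by positivity)).and
    ((Metric.tendsto_nhds.1 ly _ (show 0 < ε / 8 by positivity)).and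
    (Metric.tendsto_nhds.1 lz _ (show 0 < ε / 8 by positivity)))).exists
  have hle : ε / 8 / ((φ n : ℝ) + 1) ≤ ε / 8 := div_le_self (by positivity) (by simp)
  obtain ⟨p₀, hp₀⟩ := hX.exists_midpoint x y
  obtain ⟨p₁, hp₁⟩ := hX.exists_midpoint y z
  obtain ⟨p₂, hp₂⟩ := hX.exists_midpoint z x
  have hlimn : ¬ IsEpsNull ε [x, p₀, y, p₁, z, p₂, x] := by
    intro hcon
    obtain ⟨k₁, k₂, k₃⟩ := hT (φ n)
    refine hTn (φ n) (isEpsNull_of_close_triangle hX hε (h₀ _) (h₁ _) (h₂ _) hp₀ hp₁ hp₂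
      ?_ ?_ ?_ ?_ ?_ ?_ hnx hny hnz hcon) <;> linarith
  exact ⟨(x, y, z), isTriad_of_not_isEpsNull hX hε hp₀ hp₁ hp₂ hxy hyz hzx hlimn, _,
    isMidpointRefinement_triadLoop_iff.2 ⟨p₀, p₁, p₂, hp₀, hp₁, hp₂, rfl⟩, hlimn⟩

theorem one_le_multiplicity [CompactSpace X] (hX : IsGeodesicSpace X)
    (hε : ε ∈ criticalSpectrum X) : 1 ≤ multiplicity X ε := by
  obtain ⟨T, hT⟩ := exists_isEssentialTriad hX hε
  rw [← Set.encard_singleton T]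
  exact le_iSup (fun S : {S : Set (X × X × X) // (∀ T ∈ S, IsEssentialTriad ε T) ∧
    S.Pairwise (fun T₁ T₂ => ¬ TriadEquiv ε T₁ T₂)} => S.1.encard)
    ⟨{T}, by simpa using hT, Set.pairwise_singleton _ _⟩

end Refinement

/-! ### Counting essential triads by the pieces containing their vertices. -/

section Counting

variable {X : Type*} [MetricSpace X] {ε ε' : ℝ}

theorem IsTriad.dist_swap {T : X × X × X} (h : IsTriad ε T) : dist T.2.2 T.1 = ε := by
  rw [dist_comm]; exact h.2.2.2

/-- Nearby essential triads have the same size. -/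
theorem not_lt_of_close_triads (hX : IsGeodesicSpace X) {T T' : X × X × X}
    (hT : IsEssentialTriad ε T) (hT' : IsEssentialTriad ε' T') (h₁ : dist T.1 T'.1 < ε / 8)
    (h₂ : dist T.2.1 T'.2.1 < ε / 8) (h₃ : dist T.2.2 T'.2.2 < ε / 8) : ¬ ε' < ε := by
  intro hlt
  obtain ⟨ht, α, hα, hn⟩ := hT
  obtain ⟨m₀, m₁, m₂, a₀, a₁, a₂, rfl⟩ := isMidpointRefinement_triadLoop_iff.1 hα
  have hε := ht.1
  have ht' := hT'.1
  have k₁ := ht.2.1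
  have k₂ := ht.2.2.1
  have k₃ := ht.dist_swap
  have k₁' := ht'.2.1
  have k₂' := ht'.2.2.1
  have k₃' := ht'.dist_swap
  obtain ⟨p₀, hp₀⟩ := hX.exists_midpoint T'.1 T'.2.1
  obtain ⟨p₁, hp₁⟩ := hX.exists_midpoint T'.2.1 T'.2.2
  obtain ⟨p₂, hp₂⟩ := hX.exists_midpoint T'.2.2 T'.1
  refine hn (isEpsNull_of_close_triangle hX hε a₀ a₁ a₂ hp₀ hp₁ hp₂ ?_ ?_ ?_ ?_ ?_ ?_ h₁ h₂ h₃
    (isEpsNull_of_small_triangle hε hp₀ hp₁ hp₂ ?_ ?_ ?_)) <;> linarith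

/-- Nearby triads of the same size are equivalent. -/
theorem triadEquiv_of_close (hX : IsGeodesicSpace X) {T T' : X × X × X} (hT : IsTriad ε T)
    (hT' : IsTriad ε T') (h₁ : dist T.1 T'.1 < ε / 8) (h₂ : dist T.2.1 T'.2.1 < ε / 8)
    (h₃ : dist T.2.2 T'.2.2 < ε / 8) : TriadEquiv ε T T' := by
  have hε := hT.1
  have k₁ := hT.2.1
  have k₂ := hT.2.2.1
  have k₃ := hT.dist_swap
  have k₁' := hT'.2.1
  have k₂' := hT'.2.2.1
  have k₃' := hT'.dist_swap
  obtain ⟨m₀, hm₀⟩ := hX.exists_midpoint T.1 T.2.1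
  obtain ⟨m₁, hm₁⟩ := hX.exists_midpoint T.2.1 T.2.2
  obtain ⟨m₂, hm₂⟩ := hX.exists_midpoint T.2.2 T.1
  obtain ⟨p₀, hp₀⟩ := hX.exists_midpoint T'.1 T'.2.1
  obtain ⟨p₁, hp₁⟩ := hX.exists_midpoint T'.2.1 T'.2.2
  obtain ⟨p₂, hp₂⟩ := hX.exists_midpoint T'.2.2 T'.1
  refine ⟨_, _, isMidpointRefinement_triadLoop_iff.2 ⟨m₀, m₁, m₂, hm₀, hm₁, hm₂, rfl⟩,
    -- The orientations agree, and the base points are joined by the single step from `T.1` to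
    -- `T'.1`.
    .inl (isMidpointRefinement_triadLoop_iff.2 ⟨p₀, p₁, p₂, hp₀, hp₁, hp₂, rfl⟩),
    ⟨isEpsChain_triangle hm₀ hm₁ hm₂ ?_ ?_ ?_, rfl⟩,
    ⟨isEpsChain_triangle hp₀ hp₁ hp₂ ?_ ?_ ?_, rfl⟩, [T.1], [T.1, T'.1], ⟨by simp, by simp⟩,
    ⟨by simp, by simp; linarith⟩, rfl, rfl, rfl, ?_⟩
  iterate 6 linarith
  refine homotopic_triangles hX hε hm₀ hm₁ hm₂ hp₀ hp₁ hp₂ ?_ ?_ ?_ ?_ ?_ ?_ h₁ h₂ h₃ <;> linarith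

theorem exists_set_encard_eq_multiplicity (h : multiplicity X ε < ⊤) :
    ∃ S : Set (X × X × X), (∀ T ∈ S, IsEssentialTriad ε T) ∧
      S.Pairwise (fun T₁ T₂ => ¬ TriadEquiv ε T₁ T₂) ∧ S.encard = multiplicity X ε := by
  have : Nonempty {S : Set (X × X × X) // (∀ T ∈ S, IsEssentialTriad ε T) ∧
    S.Pairwise (fun T₁ T₂ => ¬ TriadEquiv ε T₁ T₂)} := ⟨⟨∅, by simp, by simp⟩⟩
  obtain ⟨⟨S, h₁, h₂⟩, hS⟩ := ENat.exists_eq_iSup_of_lt_top h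
  exact ⟨S, h₁, h₂, hS⟩

/-- If `X` is partitioned into `n` pieces of diameter less than `a / 8`, then there are at most
`n ^ 3` homotopy critical values greater than `a`, counted with multiplicity. -/
theorem criticalCount_le (hX : IsGeodesicSpace X) {a : ℝ} {n : ℕ} (f : X → Fin n)
    (hf : ∀ p q, f p = f q → dist p q < a / 8) : criticalCount X a ≤ (n ^ 3 : ℕ) := by
  let g : X × X × X → Fin n × Fin n × Fin n := fun T => (f T.1, f T.2.1, f T.2.2)
  have hcard : (Set.univ : Set (Fin n × Fin n × Fin n)).encard = (n ^ 3 : ℕ) := by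
    rw [Set.encard_univ, ENat.card_eq_coe_fintype_card]
    simp only [Fintype.card_prod, Fintype.card_fin]
    congr 1
    ring
  have hclose : ∀ {ε}, a < ε → ∀ {T T' : X × X × X}, g T = g T' → dist T.1 T'.1 < ε / 8 ∧
      dist T.2.1 T'.2.1 < ε / 8 ∧ dist T.2.2 T'.2.2 < ε / 8 := by
    intro ε hε T T' h
    simp only [g, Prod.mk.injEq] at h
    have h₁ := hf _ _ h.1
    have h₂ := hf _ _ h.2.1
    have h₃ := hf _ _ h.2.2
    refine ⟨?_, ?_, ?_⟩ <;> linarith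
  have hinj : ∀ {ε}, a < ε → ∀ {S : Set (X × X × X)}, (∀ T ∈ S, IsEssentialTriad ε T) →
      S.Pairwise (fun T₁ T₂ => ¬ TriadEquiv ε T₁ T₂) → Set.InjOn g S := by
    intro ε hε S hS hpw T hT T' hT' h
    by_contra hne
    obtain ⟨h₁, h₂, h₃⟩ := hclose hε h
    exact hpw hT hT' hne (triadEquiv_of_close hX (hS T hT).1 (hS T' hT').1 h₁ h₂ h₃)
  have hfin : ∀ ε, a < ε → multiplicity X ε < ⊤ := by
    intro ε hε
    refine lt_of_le_of_lt (iSup_le fun S => ?_) (ENat.natCast_lt_top (n ^ 3))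
    rw [← (hinj hε S.2.1 S.2.2).encard_image, ← hcard]
    exact Set.encard_le_encard (Set.subset_univ _)
  refine iSup_le fun F => ?_
  -- Finiteness lets the supremum be attained by an actual set. The empty set serves as a default
  -- for `ε ≤ a`.
  have hS : ∀ ε : ℝ, ∃ S : Set (X × X × X), a < ε → (∀ T ∈ S, IsEssentialTriad ε T) ∧
      S.Pairwise (fun T₁ T₂ => ¬ TriadEquiv ε T₁ T₂) ∧ S.encard = multiplicity X ε := by
    intro ε
    by_cases h : a < ε
    · obtain ⟨S, hS⟩ := exists_set_encard_eq_multiplicity (hfin ε h)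
      exact ⟨S, fun _ => hS⟩
    · exact ⟨∅, fun h' => absurd h' h⟩
  choose S hS using hS
  -- A label shared by two sizes would give close essential triads, whose sizes must agree.
  have hdisj : (F.1 : Set ℝ).PairwiseDisjoint (fun ε => g '' S ε) := by
    intro ε hε ε' hε' hne
    refine Set.disjoint_left.2 ?_
    rintro _ ⟨T, hT, rfl⟩ ⟨T', hT', h⟩
    have hεa := (F.2 ε hε).2
    have hεa' := (F.2 ε' hε').2
    obtain ⟨h₁, h₂, h₃⟩ := hclose hεa h.symm
    obtain ⟨h₁', h₂', h₃'⟩ := hclose hεa' h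
    have e := (hS ε hεa).1 T hT
    have e' := (hS ε' hεa').1 T' hT'
    exact hne (le_antisymm (not_lt.1 (not_lt_of_close_triads hX e e' h₁ h₂ h₃))
      (not_lt.1 (not_lt_of_close_triads hX e' e h₁' h₂' h₃')))
  calc ∑ ε ∈ F.1, multiplicity X ε = ∑ ε ∈ F.1, (g '' S ε).encard := by
        refine Finset.sum_congr rfl fun ε hε => ?_
        obtain ⟨h₁, h₂, h₃⟩ := hS ε (F.2 ε hε).2
        rw [(hinj (F.2 ε hε).2 h₁ h₂).encard_image, h₃]
    _ = (⋃ ε ∈ (F.1 : Set ℝ), g '' S ε).encard := by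
        rw [F.1.finite_toSet.encard_biUnion hdisj, finsum_mem_coe_finset]
    _ ≤ (n ^ 3 : ℕ) := by
        rw [← hcard]
        exact Set.encard_le_encard (Set.subset_univ _)

end Counting

/-! ### Uniform partitions from precompactness, and discreteness of the spectrum. -/

section Precompact

theorem exists_partition_of_compact (X : Type*) [MetricSpace X] [CompactSpace X] {r : ℝ}
    (hr : 0 < r) : ∃ (n : ℕ) (f : X → Fin n), ∀ p q, f p = f q → dist p q < r := by
  obtain ⟨t, -, htf, ht⟩ := (isCompact_univ (X := X)).finite_cover_balls (half_pos hr)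
  have hmem : ∀ p : X, ∃ c : t, dist p c < r / 2 := fun p => by
    simpa using ht (Set.mem_univ p)
  choose c hc using hmem
  have := htf.fintype
  refine ⟨Fintype.card t, fun p => Fintype.equivFin t (c p), fun p q h => ?_⟩
  have h' : c p = c q := (Fintype.equivFin t).injective h
  have h₁ := hc p
  have h₂ := hc q
  rw [h'] at h₁
  linarith [dist_triangle_right p q (c q : X)]

/-- A partition into small pieces of a compact space induces one of any space that is close to it in
the Gromov-Hausdorff distance. -/
theorem exists_partition_of_ghDist_lt {X Y : Type*} [MetricSpace X] [CompactSpace X] [Nonempty X]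
    [MetricSpace Y] [CompactSpace Y] [Nonempty Y] {r s : ℝ} {n : ℕ}
    (h : GromovHausdorff.ghDist X Y < r) (f : Y → Fin n) (hf : ∀ p q, f p = f q → dist p q < s) :
    ∃ f' : X → Fin n, ∀ p q, f' p = f' q → dist p q < s + 2 * r := by
  obtain ⟨Φ, Ψ, hΦ, hΨ, hd⟩ := GromovHausdorff.ghDist_eq_hausdorffDist X Y
  rw [hd] at h
  have hfin : Metric.hausdorffEDist (Set.range Φ) (Set.range Ψ) ≠ ⊤ :=
    Metric.hausdorffEDist_ne_top_of_nonempty_of_bounded (Set.range_nonempty _)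
      (Set.range_nonempty _) (isCompact_range hΦ.continuous).isBounded
      (isCompact_range hΨ.continuous).isBounded
  have hmem : ∀ p : X, ∃ q : Y, dist (Φ p) (Ψ q) < r := fun p => by
    obtain ⟨_, ⟨q, rfl⟩, hq⟩ :=
      Metric.exists_dist_lt_of_hausdorffDist_lt (Set.mem_range_self p) h hfin
    exact ⟨q, hq⟩
  choose c hc using hmem
  refine ⟨fun p => f (c p), fun p q hpq => ?_⟩
  have h₁ := hf _ _ hpq
  rw [← hΨ.dist_eq] at h₁
  rw [← hΦ.dist_eq]
  have h₂ := dist_triangle4 (Φ p) (Ψ (c p)) (Ψ (c q)) (Φ q)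
  have h₃ := hc q
  rw [dist_comm] at h₃
  linarith [hc p]

theorem IsGHPrecompact.exists_partition {ι : Type*} {X : ι → Type*} [∀ i, MetricSpace (X i)]
    [∀ i, CompactSpace (X i)] [∀ i, Nonempty (X i)] (h : IsGHPrecompact X) {r : ℝ} (hr : 0 < r) :
    ∃ n : ℕ, ∀ i, ∃ f : X i → Fin n, ∀ p q, f p = f q → dist p q < r := by
  -- Pieces of diameter below `r/2` in a representative of each centre transfer with loss `2 *
  -- (r/4)`, giving `r`. The finitely many centres have a common bound on the number of pieces.
  obtain ⟨t, -, htf, ht⟩ := h.finite_cover_balls (show 0 < r / 4 by positivity)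
  choose n f hf using fun y : GromovHausdorff.GHSpace =>
    exists_partition_of_compact y.Rep (half_pos hr)
  obtain ⟨N, hN⟩ := (htf.image n).bddAbove
  refine ⟨N, fun i => ?_⟩
  have hi := ht (subset_closure (Set.mem_range_self i))
  simp only [Set.mem_iUnion, Metric.mem_ball, exists_prop] at hi
  obtain ⟨y, hy, hiy⟩ := hi
  have hgh : GromovHausdorff.ghDist (X i) y.Rep < r / 4 := by
    rwa [GromovHausdorff.ghDist, y.toGHSpace_rep]
  obtain ⟨f', hf'⟩ := exists_partition_of_ghDist_lt hgh (f y) (hf y)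
  refine ⟨fun p => Fin.castLE (hN (Set.mem_image_of_mem n hy)) (f' p), fun p q hpq => ?_⟩
  have := hf' p q (Fin.castLE_injective _ hpq)
  linarith

theorem IsGHPrecompact.exists_criticalCount_le {ι : Type*} {X : ι → Type*}
    [∀ i, MetricSpace (X i)] [∀ i, CompactSpace (X i)] [∀ i, Nonempty (X i)]
    (hX : ∀ i, IsGeodesicSpace (X i)) (h : IsGHPrecompact X) {a : ℝ} (ha : 0 < a) :
    ∃ N : ℕ, ∀ i, criticalCount (X i) a ≤ N := by
  obtain ⟨n, hn⟩ := h.exists_partition (show 0 < a / 8 by positivity)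
  refine ⟨n ^ 3, fun i => ?_⟩
  obtain ⟨f, hf⟩ := hn i
  exact criticalCount_le (hX i) f hf

/-- A compact geodesic space has finitely many homotopy critical values greater than `a > 0`. -/
theorem finite_criticalSpectrum_inter_Ioi {X : Type*} [MetricSpace X] [CompactSpace X]
    (hX : IsGeodesicSpace X) {a : ℝ} (ha : 0 < a) : (criticalSpectrum X ∩ Set.Ioi a).Finite := by
  obtain ⟨n, f, hf⟩ := exists_partition_of_compact X (show 0 < a / 8 by positivity)
  by_contra hinf
  obtain ⟨F, hF, hcard⟩ := Set.Infinite.exists_subset_card_eq hinf (n ^ 3 + 1)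
  have h₁ : (F.card : ℕ∞) ≤ ∑ ε ∈ F, multiplicity X ε := by
    rw [Finset.cast_card]
    exact Finset.sum_le_sum fun ε hε => one_le_multiplicity hX (hF hε).1
  have h₂ : ∑ ε ∈ F, multiplicity X ε ≤ criticalCount X a :=
    le_iSup (fun F : {F : Finset ℝ // ∀ ε ∈ F, ε ∈ criticalSpectrum X ∧ a < ε} =>
      ∑ ε ∈ F.1, multiplicity X ε) ⟨F, fun ε hε => hF hε⟩
  have h₃ := (h₁.trans h₂).trans (criticalCount_le hX f hf)
  rw [hcard, Nat.cast_le] at h₃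
  omega

theorem not_accPt_criticalSpectrum {X : Type*} [MetricSpace X] [CompactSpace X]
    (hX : IsGeodesicSpace X) {t : ℝ} (ht : 0 < t) :
    ¬ AccPt t (Filter.principal (criticalSpectrum X)) := by
  intro h
  -- Accumulation at `t` is decided by values above `t / 2`, of which there are finitely many.
  refine Set.Infinite.of_accPt (x := t) (S := criticalSpectrum X ∩ Set.Ioi (t / 2)) ?_
    (finite_criticalSpectrum_inter_Ioi hX (half_pos ht))
  rw [accPt_iff_frequently] at h ⊢
  exact (h.and_eventually (Ioi_mem_nhds (half_lt_self ht))).mono fun y hy =>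
    ⟨hy.1.1, hy.1.2, hy.2⟩

end Precompact

end DiscreteHomotopy

theorem theorem1p7 :
    (∀ (ι : Type*) (X : ι → Type*) [∀ i, MetricSpace (X i)] [∀ i, CompactSpace (X i)]
        [∀ i, Nonempty (X i)],
      (∀ i, DiscreteHomotopy.IsGeodesicSpace (X i)) → DiscreteHomotopy.IsGHPrecompact X →
      ∀ a : ℝ, 0 < a → ∃ N : ℕ, ∀ i, DiscreteHomotopy.criticalCount (X i) a ≤ (N : ℕ∞)) ∧
    (∀ (Y : Type*) [MetricSpace Y] [CompactSpace Y], DiscreteHomotopy.IsGeodesicSpace Y →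
      (∀ ε ∈ DiscreteHomotopy.criticalSpectrum Y, 1 ≤ DiscreteHomotopy.multiplicity Y ε) ∧
      ∀ t : ℝ, 0 < t → ¬ AccPt t (Filter.principal (DiscreteHomotopy.criticalSpectrum Y))) := by
  refine ⟨fun ι X _ _ _ hX h a ha => h.exists_criticalCount_le hX ha, fun Y _ _ hY => ⟨?_, ?_⟩⟩
  · exact fun ε hε => DiscreteHomotopy.one_le_multiplicity hY hε
  · exact fun t ht => DiscreteHomotopy.not_accPt_criticalSpectrum hY ht
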